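/- Consider an open network of $J$ infinite server queues, initially empty. Batches arrive at the points $T_1\le T_2\le\cdots$ (finitely or infinitely many) of a non-homogeneous Poisson process on $[0,\infty)$ with measurable, locally integrable rate $\lambda:[0,\infty)\to[0,\infty)$. At time $T_i$, $\Sigma_{ij}$ customers enter at queue $j$ $(j=1,\dots,J)$, where the vectors $\mathbf\Sigma_i=(\Sigma_{i1},\dots,\Sigma_{iJ})$ are i.i.d. with values in $\{0,1,2,\dots\}^J$. The $\ell$-th customer of batch $i$ that enters at queue $j$ is at time $T_i+s$ in the location $X^j_{i,\ell}(s)$, which is one of the queues $1,\dots,J$ or the outside of the network, and $P[X^j_{i,\ell}(s)=k]=q^j_k(s)$ for all $i,\ell$, all queues $j,k$ and all $s\ge 0$. The arrival process, the vectors $\mathbf\Sigma_i$ and the processes $X^j_{i,\ell}$ are all mutually independent, and each map $(s,\omega)\mapsto X^j_{i,\ell}(s)(\omega)$ is measurable for the product of the Borel $\sigma$-algebra of $[0,\infty)$ and the $\sigma$-algebra generated by the process $X^j_{i,\ell}$ (as is the case when its paths are right-continuous). Let $\mathbf N(t)=(N_1(t),\dots,N_J(t))$, where $N_k(t)$ is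 the number of customers in queue $k$ at time $t$, and let $\mathbf C(s)=(C_1(s),\dots,C_J(s))$ be a random vector with the distribution (the same for all $i$) of $$\Bigg(\sum_{j=1}^J\sum_{\ell=1}^{\Sigma_{ij}}\mathbf 1\{X^j_{i,\ell}(s)=k\}\Bigg)_{k=1,\dots,J},$$ the numbers of customers of one batch in the different queues $s$ time units after the arrival of the batch. Theorem 5.1. Let $t\ge 0$, let $v\in\{2,\dots,J\}$, and let $n_1,\dots,n_v$ be non-negative integers with $n_v\ge 1$. Then $$P\big[\mathbf N(t)=(n_1,\dots,n_v,0,\dots,0)\big]=\sum_{i_1=0}^{n_1}\cdots\sum_{i_{v-1}=0}^{n_{v-1}}\sum_{i_v=1}^{n_v}\frac{i_v}{n_v}\,P\big[\mathbf N(t)=(n_1-i_1,\dots,n_v-i_v,0,\dots,0)\big]\int_0^t\lambda(\tau)\,P\big[\mathbf C(t-\tau)=(i_1,\dots,i_v,0,\dots,0)\big]\,d\tau ,$$ where the integrals exist (their integrands are integrable on $[0,t]$). -/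

import Mathlib

open MeasureTheory ProbabilityTheory
open scoped NNReal ENNReal

namespace BatchNetwork

variable {Ω : Type*} {J : ℕ}

/-- The number of the points `T 0 ω, T 1 ω, …` that lie in the set `B` of (finite) times.
The value `T i ω = ∞` means that there is no `i`-th point. -/
noncomputable def pointCount (T : ℕ → Ω → ℝ≥0∞) (B : Set ℝ≥0) (ω : Ω) : ℕ∞ :=
  {i : ℕ | ∃ s ∈ B, T i ω = (s : ℝ≥0∞)}.encard

/-- Lebesgue measure on the time axis `[0, ∞)`: the measure of `B` is that of `B` as a subset of the
real line. -/
noncomputable def lebesgue : Measure ℝ≥0 :=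
  (volume : Measure ℝ).comap ((↑) : ℝ≥0 → ℝ)

/-- The intensity measure `B ↦ ∫_B lam(τ) dτ` on the time axis `[0, ∞)`. -/
noncomputable def intensity (lam : ℝ≥0 → ℝ≥0) : Measure ℝ≥0 :=
  lebesgue.withDensity fun τ => (lam τ : ℝ≥0∞)

/-- `T 0 ≤ T 1 ≤ …` are the points of a (non-homogeneous) Poisson process on `[0, ∞)` with
locally integrable rate function `lam`: the number of points in a Borel set of finite intensity is
Poisson distributed, with the intensity of the set as its mean, and the numbers of points in
pairwise disjoint Borel sets are independent. -/
structure IsPoissonProcess [MeasurableSpace Ω] (μ : Measure Ω) (lam : ℝ≥0 → ℝ≥0)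
    (T : ℕ → Ω → ℝ≥0∞) : Prop where
  measurable_rate : Measurable lam
  intensity_lt_top : ∀ t : ℝ≥0, intensity lam (Set.Iic t) < ∞
  measurable : ∀ i, Measurable (T i)
  mono : ∀ᵐ ω ∂μ, Monotone fun i => T i ω
  hasLaw_pointCount : ∀ B : Set ℝ≥0, MeasurableSet B → intensity lam B < ∞ →
    HasLaw (pointCount T B)
      ((poissonMeasure (intensity lam B).toNNReal).map (Nat.cast : ℕ → ℕ∞)) μ
  indep_pointCount : ∀ (m : ℕ) (B : Fin m → Set ℝ≥0), (∀ r, MeasurableSet (B r)) →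
    Pairwise (fun r r' => Disjoint (B r) (B r')) → iIndepFun (fun r => pointCount T (B r)) μ

/-- The σ-algebra generated by a process `Y s`, `s ≥ 0`, of locations. A location is a queue
`some k` or `none`, which stands for being outside the network. -/
@[reducible] def routeSigma (Y : ℝ≥0 → Ω → Option (Fin J)) : MeasurableSpace Ω :=
  ⨆ s : ℝ≥0, MeasurableSpace.comap (Y s) ⊤

/-- The independent sources of randomness: the arrival process, the size vector of each batch, and
the route of each potential customer (batch `i`, entry queue `j`, number `ℓ` among the customers of
that batch entering there). -/
inductive Source (J : ℕ) : Type
  | arrivals : Source J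
  | batch (i : ℕ) : Source J
  | route (i : ℕ) (j : Fin J) (ℓ : ℕ) : Source J

/-- The σ-algebra generated by each source of randomness. -/
@[reducible] def sourceSigma (T : ℕ → Ω → ℝ≥0∞) (S : ℕ → Ω → Fin J → ℕ)
    (X : ℕ → Fin J → ℕ → ℝ≥0 → Ω → Option (Fin J)) : Source J → MeasurableSpace Ω
  | .arrivals => ⨆ i : ℕ, MeasurableSpace.comap (T i) inferInstance
  | .batch i => MeasurableSpace.comap (S i) inferInstance
  | .route i j ℓ => routeSigma (X i j ℓ)

/-- The open network of `J` infinite server queues with multivariate batch Poisson arrivals.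

* Batch `i` arrives at time `T i`; these times form a Poisson process with rate `lam`.
* `S i ω j` customers of batch `i` enter at queue `j`; the vectors `S i` have a common law.
* `X i j ℓ s` is the location, `s` time units after the arrival of the batch, of customer `ℓ` among
  those of batch `i` that enter at queue `j`; this is queue `k` with probability `q j k s`.
* The arrival process, the batch size vectors and all the routes are mutually independent.

Each route is a measurable process, jointly in time and in its own randomness, as is the case when
its paths are right-continuous. -/
structure IsNetwork [MeasurableSpace Ω] (μ : Measure Ω) (lam : ℝ≥0 → ℝ≥0)
    (q : Fin J → Fin J → ℝ≥0 → ℝ) (T : ℕ → Ω → ℝ≥0∞) (S : ℕ → Ω → Fin J → ℕ)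
    (X : ℕ → Fin J → ℕ → ℝ≥0 → Ω → Option (Fin J)) : Prop where
  poisson : IsPoissonProcess μ lam T
  measurable_batch : ∀ i, Measurable (S i)
  identDistrib_batch : ∀ i, IdentDistrib (S i) (S 0) μ μ
  measurable_route : ∀ i j ℓ s, Measurable[_, ⊤] (X i j ℓ s)
  jointly_measurable_route : ∀ i j ℓ,
    Measurable[MeasurableSpace.prod inferInstance (routeSigma (X i j ℓ)), ⊤]
      fun p : ℝ≥0 × Ω => X i j ℓ p.1 p.2
  route_law : ∀ i j ℓ k s, μ.real {ω | X i j ℓ s ω = some k} = q j k s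
  indep : iIndep (sourceSigma T S X) μ

/-- `C_{i,k}(s)`: the number of customers of batch `i` that are in queue `k` at `s` time units after
the arrival of the batch. -/
def batchOccupancy (S : ℕ → Ω → Fin J → ℕ) (X : ℕ → Fin J → ℕ → ℝ≥0 → Ω → Option (Fin J))
    (i : ℕ) (s : ℝ≥0) (ω : Ω) (k : Fin J) : ℕ :=
  ∑ j : Fin J, ∑ ℓ ∈ Finset.range (S i ω j), if X i j ℓ s ω = some k then 1 else 0

/-- `N_k(t)`: the number of customers (triples of batch `i`, entry queue `j` and number `ℓ`) that
arrived at some time `τ ≤ t` and are in queue `k` at time `t`. The network is empty before the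
first arrival. -/
noncomputable def occupancy (T : ℕ → Ω → ℝ≥0∞) (S : ℕ → Ω → Fin J → ℕ)
    (X : ℕ → Fin J → ℕ → ℝ≥0 → Ω → Option (Fin J)) (t : ℝ≥0) (ω : Ω) (k : Fin J) : ℕ∞ :=
  {c : ℕ × Fin J × ℕ | ∃ τ : ℝ≥0, T c.1 ω = (τ : ℝ≥0∞) ∧ τ ≤ t ∧ c.2.2 < S c.1 ω c.2.1 ∧
    X c.1 c.2.1 c.2.2 (t - τ) ω = some k}.encard

/-- `P[N(t) = n]`. -/
noncomputable def occupancyPMF [MeasurableSpace Ω] (μ : Measure Ω) (T : ℕ → Ω → ℝ≥0∞)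
    (S : ℕ → Ω → Fin J → ℕ) (X : ℕ → Fin J → ℕ → ℝ≥0 → Ω → Option (Fin J)) (t : ℝ≥0)
    (n : Fin J → ℕ) : ℝ :=
  μ.real {ω | ∀ k, occupancy T S X t ω k = (n k : ℕ∞)}

/-- `P[C_b(s) = c]`, for the customers of batch `b`. -/
noncomputable def batchPMF [MeasurableSpace Ω] (μ : Measure Ω) (S : ℕ → Ω → Fin J → ℕ)
    (X : ℕ → Fin J → ℕ → ℝ≥0 → Ω → Option (Fin J)) (b : ℕ) (s : ℝ≥0) (c : Fin J → ℕ) : ℝ :=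
  μ.real {ω | ∀ k, batchOccupancy S X b s ω k = c k}

end BatchNetwork

/-! Mark each batch that arrives by time t with the vector of the positions of its customers at time
t. Then N(t) is a sum of a Poisson number of independent vectors: its law is compound Poisson with
parameter measure ν, where ν{i} = ∫₀ᵗ λ(τ) P[C(t-τ) = i] dτ (`batchIntensity`,
`IsNetwork.map_totalCount`). Every compound Poisson law P satisfies Panjer's recursion n_v P{n} =
Σ_{i ≤ n} i_v P{n-i} ν{i} (`compoundPoisson_singleton`): each of m+1 exchangeable summands
contributes equally to the v-th coordinate of the sum, and the factor m+1 cancels against (m+1)!.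
Division by n_v gives the theorem.

The law is identified by its generating function on [0,1]^J, which determines a finite measure
(`ext_of_lintegral_monom`). For fixed arrival times the batches are independent, so the generating
function is the product of y(T_i) over T_i ≤ t, where y(τ) = E z^C(t-τ)
(`IsNetwork.lintegral_prod_monom_batchCount`). The Laplace functional of the Poisson process
(`IsPoissonProcess.lintegral_finprod_upTo`) turns the mean of this product into exp ∫₀ᵗ (y-1)λ,
which is the generating function of the compound Poisson law (`lintegral_monom_compoundPoisson`).
Fixing one source of randomness is always an application of Tonelli
(`lintegral_comp_prodMk_of_indep`). -/

namespace BatchNetwork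

/-! ### Freezing an independent variable -/

section Independence

variable {Ω α : Type*} [MeasurableSpace α]

/-- By independence the pair of `U` and the identity map into (Ω, `𝓖`) has a product law, so Tonelli
applies. Keeping Ω itself as second factor avoids encoding whole routes, indexed by a continuum of
times, as one random variable. -/
theorem lintegral_comp_prodMk_of_indep {mΩ : MeasurableSpace Ω} {μ : Measure Ω}
    [IsProbabilityMeasure μ] {U : Ω → α} (hU : Measurable U) {𝓖 : MeasurableSpace Ω}
    (h𝓖 : 𝓖 ≤ mΩ) (h : Indep (MeasurableSpace.comap U inferInstance) 𝓖 μ)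
    {F : α × Ω → ℝ≥0∞} (hF : Measurable[MeasurableSpace.prod inferInstance 𝓖] F) :
    ∫⁻ ω, F (U ω, ω) ∂μ = ∫⁻ ω, ∫⁻ ω', F (U ω, ω') ∂μ ∂μ := by
  have hid : @Measurable Ω Ω mΩ 𝓖 id := measurable_id.mono le_rfl h𝓖
  have hind : @IndepFun Ω α Ω mΩ _ 𝓖 U id μ := by
    rw [IndepFun_iff_Indep, MeasurableSpace.comap_id]
    exact h
  have hmap := (@indepFun_iff_map_prod_eq_prod_map_map Ω α Ω mΩ μ U id _ 𝓖 _
    hU.aemeasurable hid.aemeasurable).1 hind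
  have hpair : @Measurable Ω (α × Ω) mΩ (MeasurableSpace.prod inferInstance 𝓖)
      (fun ω => (U ω, id ω)) := by
    exact @Measurable.prodMk Ω mΩ α Ω _ 𝓖 _ _ hU hid
  have h1 := @lintegral_map Ω (α × Ω) mΩ (MeasurableSpace.prod inferInstance 𝓖) μ F _ hF hpair
  have hfin : @IsProbabilityMeasure Ω 𝓖 (@Measure.map Ω Ω mΩ 𝓖 id μ) :=
    @Measure.isProbabilityMeasure_map Ω Ω mΩ 𝓖 μ _ id hid.aemeasurable
  rw [hmap] at h1
  have hFs : ∀ a, Measurable[𝓖] fun ω' => F (a, ω') := fun a =>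
    hF.comp (@measurable_prodMk_left _ _ _ 𝓖 a)
  rw [@lintegral_prod α Ω _ 𝓖 _ _ _ F (@Measurable.aemeasurable _ _ _ _ _ (_) hF)] at h1
  have hin : Measurable fun a => ∫⁻ ω', F (a, ω') ∂(@Measure.map Ω Ω mΩ 𝓖 id μ) :=
    @Measurable.lintegral_prod_right' α Ω _ 𝓖 _ _ F hF
  rw [@lintegral_map Ω α mΩ _ μ _ U hin hU] at h1
  refine h1.symm.trans (lintegral_congr fun ω => ?_)
  exact @lintegral_map Ω Ω mΩ 𝓖 μ _ id (hFs (U ω)) hid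

end Independence

/-! ### Generating functions on ℕ^J -/

section GeneratingFunction

variable {J : ℕ}

/-- The monomial `∏ k, z k ^ x k`. -/
def monom (z : Fin J → ℝ≥0) (x : Fin J → ℕ) : ℝ≥0 := ∏ k, z k ^ x k

theorem monom_add (z : Fin J → ℝ≥0) (x y : Fin J → ℕ) :
    monom z (x + y) = monom z x * monom z y := by
  simp [monom, pow_add, Finset.prod_mul_distrib]

theorem monom_zero (z : Fin J → ℝ≥0) : monom z 0 = 1 := by simp [monom]

theorem monom_mul (z w : Fin J → ℝ≥0) (x : Fin J → ℕ) :
    monom (z * w) x = monom z x * monom w x := by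
  simp [monom, mul_pow, Finset.prod_mul_distrib]

theorem monom_sum {ι : Type*} (z : Fin J → ℝ≥0) (s : Finset ι) (x : ι → Fin J → ℕ) :
    monom z (∑ i ∈ s, x i) = ∏ i ∈ s, monom z (x i) := by
  classical
  induction s using Finset.induction_on with
  | empty => simp [monom_zero]
  | insert a s ha ih => rw [Finset.sum_insert ha, Finset.prod_insert ha, monom_add, ih]

theorem monom_le_one {z : Fin J → ℝ≥0} (hz : ∀ k, z k ≤ 1) (x : Fin J → ℕ) : monom z x ≤ 1 :=
  Finset.prod_le_one' fun k _ => pow_le_one' (hz k) _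

/-- A monomial with parameters in `[0, 1]`, as a bounded continuous function. -/
noncomputable def monomBCF (z : Fin J → ℝ≥0) (hz : ∀ k, z k ≤ 1) :
    BoundedContinuousFunction (Fin J → ℕ) ℝ :=
  BoundedContinuousFunction.mkOfBound ⟨fun x => (monom z x : ℝ), continuous_of_discreteTopology⟩ 1
    fun x y => by
      have h (x : Fin J → ℕ) : (0 : ℝ) ≤ monom z x ∧ (monom z x : ℝ) ≤ 1 :=
        ⟨NNReal.coe_nonneg _, by exact_mod_cast monom_le_one hz x⟩
      rw [Real.dist_eq, abs_le]
      constructor <;> simp <;> linarith [(h x).1, (h x).2, (h y).1, (h y).2]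

/-- The monomials with parameters in `[0, 1]`, as a monoid of bounded continuous functions. -/
noncomputable def monomSubmonoid (J : ℕ) :
    Submonoid (BoundedContinuousFunction (Fin J → ℕ) ℝ) where
  carrier := {g | ∃ (z : Fin J → ℝ≥0) (hz : ∀ k, z k ≤ 1), g = monomBCF z hz}
  one_mem' := ⟨1, fun _ => le_rfl, by ext x; simp [monomBCF, monom]⟩
  mul_mem' := by
    rintro _ _ ⟨z, hz, rfl⟩ ⟨w, hw, rfl⟩
    exact ⟨z * w, fun k => mul_le_one' (hz k) (hw k), by ext x; simp [monomBCF, monom_mul]⟩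

/-- A finite measure on `ℕ ^ J` is determined by its generating function on `[0, 1] ^ J`. -/
theorem ext_of_lintegral_monom {P Q : Measure (Fin J → ℕ)} [IsFiniteMeasure P] [IsFiniteMeasure Q]
    (h : ∀ z : Fin J → ℝ≥0, (∀ k, z k ≤ 1) →
      ∫⁻ x, (monom z x : ℝ≥0∞) ∂P = ∫⁻ x, (monom z x : ℝ≥0∞) ∂Q) : P = Q := by
  -- A point-separating algebra of bounded continuous functions determines a finite measure.
  -- Monomials are closed under products, so the algebra they generate is their linear span and
  -- linearity reduces everything to `h`.
  let A : StarSubalgebra ℝ (BoundedContinuousFunction (Fin J → ℕ) ℝ) :=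
    { Algebra.adjoin ℝ (monomSubmonoid J : Set (BoundedContinuousFunction (Fin J → ℕ) ℝ)) with
      star_mem' := fun {a} ha => by
        have : star a = a := by ext; simp
        rw [this]; exact ha }
  refine ext_of_forall_mem_subalgebra_integral_eq_of_pseudoEMetric_complete_countable
    (𝕜 := ℝ) (A := A) ?_ ?_
  · intro x y hxy
    obtain ⟨k, hk⟩ := Function.ne_iff.1 hxy
    -- Where x and y differ in coordinate k, the monomial (1/2)^(x k) separates them, as powers of
    -- 1/2 are distinct.
    have hz : ∀ k', (Function.update 1 k (1 / 2) : Fin J → ℝ≥0) k' ≤ 1 := by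
      intro k'
      by_cases hkk : k' = k
      · subst hkk; simp
      · simp [Function.update_of_ne hkk]
    have hm (x : Fin J → ℕ) : monom (Function.update 1 k (1 / 2)) x = (1 / 2) ^ x k := by
      rw [monom, Finset.prod_eq_single k]
      · simp
      · intro b _ hb; simp [Function.update_of_ne hb]
      · simp
    refine ⟨_, ⟨_, ⟨monomBCF _ hz, Algebra.subset_adjoin ⟨_, hz, rfl⟩, rfl⟩, rfl⟩, ?_⟩
    simp only [monomBCF]
    intro he
    apply hk
    have he' : (monom (Function.update 1 k (1 / 2)) x : ℝ)
      = (monom (Function.update 1 k (1 / 2)) y : ℝ) := he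
    rw [hm, hm] at he'
    push_cast at he'
    exact pow_right_injective₀ (by norm_num) (by norm_num) he'
  · intro g hg
    have hg' : g ∈ Submodule.span ℝ
        (monomSubmonoid J : Set (BoundedContinuousFunction (Fin J → ℕ) ℝ)) := by
      have : g ∈ Algebra.adjoin ℝ
        (monomSubmonoid J : Set (BoundedContinuousFunction (Fin J → ℕ) ℝ)) := hg
      rw [← Subalgebra.mem_toSubmodule, Algebra.adjoin_eq_span, Submonoid.closure_eq] at this
      exact this
    clear hg
    induction hg' using Submodule.span_induction with
    | mem g hg =>
      obtain ⟨z, hz, rfl⟩ := hg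
      have key (ρ : Measure (Fin J → ℕ)) :
          ∫ x, (monomBCF z hz) x ∂ρ = (∫⁻ x, (monom z x : ℝ≥0∞) ∂ρ).toReal := by
        change ∫ x, (monom z x : ℝ) ∂ρ = _
        rw [integral_eq_lintegral_of_nonneg_ae
          (Filter.Eventually.of_forall fun x => NNReal.coe_nonneg _)
          (measurable_of_countable _).aestronglyMeasurable]
        simp
      rw [key, key, h z hz]
    | zero => simp
    | add f g _ _ hf hg =>
      simp only [BoundedContinuousFunction.coe_add, Pi.add_apply]
      rw [integral_add (f.integrable _) (g.integrable _),
        integral_add (f.integrable _) (g.integrable _)]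
      rw [hf, hg]
    | smul a f _ hf =>
      simp only [BoundedContinuousFunction.coe_smul, integral_smul]
      rw [hf]

end GeneratingFunction

/-! ### Compound Poisson laws and Panjer's recursion -/

section CompoundPoisson

variable {J : ℕ}

/-- The convolution powers of a measure. -/
noncomputable def convPow (ν : Measure (Fin J → ℕ)) : ℕ → Measure (Fin J → ℕ)
  | 0 => Measure.dirac 0
  | m + 1 => ν ∗ convPow ν m

instance (ν : Measure (Fin J → ℕ)) [SFinite ν] (m : ℕ) : SFinite (convPow ν m) := by
  induction m with
  | zero => unfold convPow; infer_instance
  | succ m ih => unfold convPow; infer_instance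

theorem lintegral_monom_convPow (z : Fin J → ℝ≥0) (ν : Measure (Fin J → ℕ)) [SFinite ν] (m : ℕ) :
    ∫⁻ x, (monom z x : ℝ≥0∞) ∂(convPow ν m) = (∫⁻ x, (monom z x : ℝ≥0∞) ∂ν) ^ m := by
  induction m with
  | zero => simp [convPow, monom_zero]
  | succ m ih =>
    rw [convPow, Measure.lintegral_conv (measurable_of_countable _)]
    simp_rw [monom_add, ENNReal.coe_mul]
    simp_rw [lintegral_const_mul _ (measurable_of_countable _), ih]
    rw [lintegral_mul_const _ (measurable_of_countable _), pow_succ']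

/-- By additivity `g` of the sum splits into m+1 terms, one per summand; by symmetry they have equal
integrals, so one summand can be singled out. -/
theorem lintegral_additive_mul_convPow_succ (ν : Measure (Fin J → ℕ)) [SFinite ν]
    {g : (Fin J → ℕ) → ℝ≥0∞} (hg : ∀ x y, g (x + y) = g x + g y) (m : ℕ)
    (f : (Fin J → ℕ) → ℝ≥0∞) :
    ∫⁻ x, g x * f x ∂(convPow ν (m + 1)) =
      (m + 1) * ∫⁻ x, g x * ∫⁻ y, f (x + y) ∂(convPow ν m) ∂ν := by
  induction m generalizing f with
  | zero =>
    rw [show convPow ν (0 + 1) = ν ∗ Measure.dirac 0 from rfl]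
    simp [convPow]
  | succ m ih =>
    rw [convPow, Measure.lintegral_conv (measurable_of_countable _)]
    simp_rw [hg, add_mul]
    simp_rw [lintegral_add_left (measurable_of_countable _),
      lintegral_const_mul _ (measurable_of_countable _)]
    simp_rw [ih (fun y => f (_ + y))]
    rw [lintegral_const_mul _ (measurable_of_countable _),
      lintegral_lintegral_swap (measurable_of_countable _).aemeasurable]
    simp_rw [lintegral_const_mul _ (measurable_of_countable _)]
    -- The vector peeled off first is absorbed into the remaining m, which leaves the singled-out
    -- vector y in its place.
    have : ∀ y, ∫⁻ x, ∫⁻ y', f (x + (y + y')) ∂(convPow ν m) ∂ν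
        = ∫⁻ y', f (y + y') ∂(convPow ν (m + 1)) := by
      intro y
      rw [convPow, Measure.lintegral_conv (measurable_of_countable _)]
      simp_rw [add_left_comm]
    simp_rw [this]
    push_cast
    ring

/-- The law of the sum of a Poisson number of independent vectors, where `ν` is the law of one
vector times the mean of their number. -/
noncomputable def compoundPoisson (ν : Measure (Fin J → ℕ)) : Measure (Fin J → ℕ) :=
  Measure.sum fun m => ENNReal.ofReal (Real.exp (-ν.real Set.univ) / m.factorial) • convPow ν m

theorem lintegral_monom_compoundPoisson (z : Fin J → ℝ≥0) (hz : ∀ k, z k ≤ 1)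
    (ν : Measure (Fin J → ℕ)) [IsFiniteMeasure ν] :
    ∫⁻ x, (monom z x : ℝ≥0∞) ∂(compoundPoisson ν) =
      ENNReal.ofReal (Real.exp ((∫⁻ x, (monom z x : ℝ≥0∞) ∂ν).toReal - ν.real Set.univ)) := by
  have hfin : ∫⁻ x, (monom z x : ℝ≥0∞) ∂ν ≠ ∞ := by
    refine ne_top_of_le_ne_top (measure_ne_top ν Set.univ) ?_
    rw [← lintegral_one]
    exact lintegral_mono fun x => ENNReal.coe_le_one_iff.2 (monom_le_one hz x)
  set a := (∫⁻ x, (monom z x : ℝ≥0∞) ∂ν).toReal with ha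
  rw [compoundPoisson, lintegral_sum_measure]
  simp_rw [lintegral_smul_measure, lintegral_monom_convPow]
  have : ∀ m : ℕ, ENNReal.ofReal (Real.exp (-ν.real Set.univ) / m.factorial) •
      (∫⁻ x, (monom z x : ℝ≥0∞) ∂ν) ^ m =
      ENNReal.ofReal (Real.exp (-ν.real Set.univ) * (a ^ m / m.factorial)) := by
    intro m
    rw [← ENNReal.ofReal_toReal hfin, ← ha, ← ENNReal.ofReal_pow ENNReal.toReal_nonneg,
      smul_eq_mul, ← ENNReal.ofReal_mul (by positivity)]
    congr 1; ring
  simp_rw [this]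
  have hs := (NormedSpace.expSeries_div_hasSum_exp (𝔸 := ℝ) a).mul_left
    (Real.exp (-ν.real Set.univ))
  have ha0 : 0 ≤ a := ENNReal.toReal_nonneg
  rw [← ENNReal.ofReal_tsum_of_nonneg (fun m => by positivity) hs.summable, hs.tsum_eq,
    ← Real.exp_eq_exp_ℝ, ← Real.exp_add, neg_add_eq_sub]

instance (ν : Measure (Fin J → ℕ)) [IsFiniteMeasure ν] : IsFiniteMeasure (compoundPoisson ν) := by
  -- At z = 1 the generating function is the total mass.
  have := lintegral_monom_compoundPoisson 1 (fun _ => le_rfl) ν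
  simp only [monom, Pi.one_apply, one_pow, Finset.prod_const_one, ENNReal.coe_one,
    lintegral_one] at this
  exact ⟨by rw [this]; exact ENNReal.ofReal_lt_top⟩

/-- The term with no summands vanishes by `hg0`, which additivity alone does not give since `g 0`
could be ∞. In the others (m+1)/(m+1)! = 1/m! restores the weights of the compound Poisson law. -/
theorem lintegral_additive_mul_compoundPoisson (ν : Measure (Fin J → ℕ)) [IsFiniteMeasure ν]
    {g : (Fin J → ℕ) → ℝ≥0∞} (hg : ∀ x y, g (x + y) = g x + g y) (hg0 : g 0 = 0)
    (f : (Fin J → ℕ) → ℝ≥0∞) :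
    ∫⁻ x, g x * f x ∂(compoundPoisson ν) =
      ∫⁻ x, g x * ∫⁻ y, f (x + y) ∂(compoundPoisson ν) ∂ν := by
  simp_rw [compoundPoisson, lintegral_sum_measure, lintegral_smul_measure, smul_eq_mul,
    ← ENNReal.tsum_mul_left]
  rw [lintegral_tsum fun _ => (measurable_of_countable _).aemeasurable,
    tsum_eq_zero_add' ENNReal.summable]
  have h0 : ∫⁻ x, g x * f x ∂(convPow ν 0) = 0 := by
    simp [convPow, hg0]
  rw [h0, mul_zero, zero_add]
  refine tsum_congr fun m => ?_
  rw [lintegral_additive_mul_convPow_succ ν hg]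
  simp_rw [mul_left_comm (g _)]
  rw [lintegral_const_mul _ (measurable_of_countable _), ← mul_assoc]
  congr 1
  have : ((m : ℝ≥0∞) + 1) = ENNReal.ofReal (m + 1) := by
    rw [ENNReal.ofReal_add (by positivity) (by positivity)]; simp
  rw [this, ← ENNReal.ofReal_mul (by positivity), Nat.factorial_succ]
  congr 1
  push_cast
  field_simp

/-- Panjer's recursion. -/
theorem compoundPoisson_singleton (ν : Measure (Fin J → ℕ)) [IsFiniteMeasure ν] (v : Fin J)
    (n : Fin J → ℕ) :
    (n v : ℝ≥0∞) * compoundPoisson ν {n} =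
      ∑ i ∈ Finset.Iic n, (i v : ℝ≥0∞) * compoundPoisson ν {n - i} * ν {i} := by
  -- The additive functional is the v-th coordinate and `f` is the indicator of n; only i ≤ n can be
  -- completed to n, which makes the sum finite.
  have h := lintegral_additive_mul_compoundPoisson ν (g := fun x => (x v : ℝ≥0∞))
    (fun x y => by simp) (by simp) (Set.indicator {n} 1)
  have hl : ∫⁻ x, (x v : ℝ≥0∞) * Set.indicator {n} 1 x ∂(compoundPoisson ν) =
      (n v : ℝ≥0∞) * compoundPoisson ν {n} := by
    rw [lintegral_countable', tsum_eq_single n]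
    · simp
    · intro x hx; simp [hx]
  rw [← hl, h, lintegral_countable', tsum_eq_sum (s := Finset.Iic n)]
  · refine Finset.sum_congr rfl fun i hi => ?_
    congr 2
    have : (fun y => Set.indicator {n} (1 : (Fin J → ℕ) → ℝ≥0∞) (i + y)) =
        Set.indicator {n - i} 1 := by
      ext y
      have : i + y = n ↔ y = n - i := by
        constructor
        · rintro rfl; simp
        · rintro rfl; exact add_tsub_cancel_of_le (Finset.mem_Iic.1 hi)
      simp [Set.indicator, this]
    rw [this, lintegral_indicator_one (measurableSet_singleton _)]
  · intro i hi
    have : ∀ y, Set.indicator {n} (1 : (Fin J → ℕ) → ℝ≥0∞) (i + y) = 0 := by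
      intro y
      refine Set.indicator_of_notMem ?_ _
      rintro rfl
      exact hi (Finset.mem_Iic.2 (le_add_of_nonneg_right zero_le))
    simp [this]

end CompoundPoisson

/-! ### The Laplace functional of a Poisson process -/

theorem lintegral_pow_poissonMeasure (r : ℝ≥0) (c : ℝ≥0) :
    ∫⁻ n, (c : ℝ≥0∞) ^ n ∂(poissonMeasure r) = ENNReal.ofReal (Real.exp (c * r - r)) := by
  rw [poissonMeasure, lintegral_sum_measure]
  simp_rw [lintegral_smul_measure, lintegral_dirac, smul_eq_mul]
  have : ∀ m : ℕ, ENNReal.ofReal (Real.exp (-r) * r ^ m / m.factorial) * (c : ℝ≥0∞) ^ m =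
      ENNReal.ofReal (Real.exp (-r) * ((c * r : ℝ) ^ m / m.factorial)) := by
    intro m
    rw [← ENNReal.ofReal_coe_nnreal (p := c), ← ENNReal.ofReal_pow (NNReal.coe_nonneg c), ← ENNReal.ofReal_mul (by positivity)]
    congr 1
    rw [mul_pow]; ring
  simp_rw [this]
  have hs := (NormedSpace.expSeries_div_hasSum_exp (𝔸 := ℝ) (c * r)).mul_left (Real.exp (-r))
  rw [← ENNReal.ofReal_tsum_of_nonneg (fun m => by positivity) hs.summable, hs.tsum_eq,
    ← Real.exp_eq_exp_ℝ, ← Real.exp_add, neg_add_eq_sub]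

section PoissonProcess

open Filter Topology

variable {Ω : Type*} {T : ℕ → Ω → ℝ≥0∞}

/-- The bound `T i ω ≤ t` excludes absent points, for which `toNNReal` would return the default 0.
-/
theorem setOf_exists_mem_eq_coe (t : ℝ≥0) (B : Set ℝ≥0) (ω : Ω) (hB : B ⊆ Set.Iic t) :
    {i : ℕ | ∃ s ∈ B, T i ω = (s : ℝ≥0∞)} = {i | T i ω ≤ t ∧ (T i ω).toNNReal ∈ B} := by
  ext i
  constructor
  · rintro ⟨s, hs, h⟩
    simp only [Set.mem_ofPred_eq, h, ENNReal.toNNReal_coe]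
    exact ⟨ENNReal.coe_le_coe.2 (hB hs), hs⟩
  · rintro ⟨h, h'⟩
    exact ⟨_, h', (ENNReal.coe_toNNReal (ne_top_of_le_ne_top ENNReal.coe_ne_top h)).symm⟩

/-- `f` before time `t`, and `1` after that time. -/
noncomputable def upTo (t : ℝ≥0) (f : ℝ≥0 → ℝ≥0∞) (x : ℝ≥0∞) : ℝ≥0∞ :=
  if x ≤ t then f x.toNNReal else 1

theorem measurable_upTo (t : ℝ≥0) {f : ℝ≥0 → ℝ≥0∞} (hf : Measurable f) : Measurable (upTo t f) :=
  Measurable.ite measurableSet_Iic (hf.comp ENNReal.measurable_toNNReal) measurable_const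

theorem upTo_le_one (t : ℝ≥0) {f : ℝ≥0 → ℝ≥0∞} (hf : ∀ s, f s ≤ 1) (x : ℝ≥0∞) :
    upTo t f x ≤ 1 := by
  unfold upTo; split_ifs
  exacts [hf _, le_rfl]

theorem prod_range_eventually_eq {M : Type*} [CommMonoid M] {a : ℕ → M} {I : Finset ℕ}
    (h : ∀ i ∉ I, a i = 1) : ∀ᶠ m in atTop, ∏ i ∈ Finset.range m, a i = ∏ i ∈ I, a i := by
  obtain ⟨m, hm⟩ := I.exists_nat_subset_range
  filter_upwards [eventually_ge_atTop m] with m' hm'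
  refine (Finset.prod_subset (hm.trans ?_) fun i _ hi => h i hi).symm
  exact Finset.range_subset_range.2 hm'

theorem finprod_upTo {t : ℝ≥0} {ω : Ω} (hω : {i | T i ω ≤ t}.Finite) (f : ℝ≥0 → ℝ≥0∞) :
    ∏ᶠ i, upTo t f (T i ω) = ∏ i ∈ hω.toFinset, f (T i ω).toNNReal := by
  rw [finprod_eq_prod_of_mulSupport_subset (s := hω.toFinset)]
  · refine Finset.prod_congr rfl fun i hi => ?_
    rw [upTo, if_pos (by simpa using hi)]
  · intro i hi
    by_contra h
    exact hi (if_neg (by simpa using h))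

theorem tendsto_prod_upTo {t : ℝ≥0} {ω : Ω} (hω : {i | T i ω ≤ t}.Finite) (f : ℝ≥0 → ℝ≥0∞) :
    Tendsto (fun m => ∏ i ∈ Finset.range m, upTo t f (T i ω)) atTop
      (𝓝 (∏ᶠ i, upTo t f (T i ω))) := by
  refine tendsto_const_nhds.congr' ?_
  rw [finprod_eq_prod_of_mulSupport_subset (s := hω.toFinset)]
  · refine (prod_range_eventually_eq fun i hi => ?_).mono fun m hm => hm.symm
    rw [upTo, if_neg (by simpa using hi)]
  · intro i hi
    by_contra h
    exact hi (if_neg (by simpa using h))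

variable [MeasurableSpace Ω] {μ : Measure Ω} {lam : ℝ≥0 → ℝ≥0}

/-- A Poisson law charges only finite counts. Thus almost surely the later `finprod` and `finsum`
over batches are true finite products and sums. -/
theorem IsPoissonProcess.ae_finite (hT : IsPoissonProcess μ lam T) (t : ℝ≥0) :
    ∀ᵐ ω ∂μ, {i | T i ω ≤ t}.Finite := by
  have h := hT.hasLaw_pointCount (Set.Iic t) measurableSet_Iic (hT.intensity_lt_top t)
  have h1 : ∀ᵐ x ∂(μ.map (pointCount T (Set.Iic t))), x ≠ ⊤ := by
    rw [h.map_eq, ae_map_iff (measurable_of_countable _).aemeasurable (MeasurableSet.of_discrete)]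
    exact Eventually.of_forall fun n => ENat.natCast_ne_top n
  filter_upwards [ae_of_ae_map h.aemeasurable h1] with ω hω
  rw [pointCount, Set.encard_ne_top_iff, setOf_exists_mem_eq_coe t _ _ subset_rfl] at hω
  refine hω.subset fun i hi => ⟨hi, ?_⟩
  exact ENNReal.toNNReal_mono ENNReal.coe_ne_top hi

/-- Independence over disjoint sets factors the mean into Poisson generating functions. The counts
are only a.e. measurable, so measurable versions stand in for them. -/
theorem IsPoissonProcess.lintegral_prod_pointCount [IsProbabilityMeasure μ]
    (hT : IsPoissonProcess μ lam T) {ι : Type*} [Fintype ι] (B : ι → Set ℝ≥0)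
    (hB : ∀ r, MeasurableSet (B r)) (hBd : Pairwise fun r r' => Disjoint (B r) (B r'))
    (hBf : ∀ r, intensity lam (B r) < ∞) (c : ι → ℝ≥0) :
    ∫⁻ ω, ∏ r, (c r : ℝ≥0∞) ^ (pointCount T (B r) ω).toNat ∂μ =
      ENNReal.ofReal (Real.exp (∑ r, (c r * (intensity lam (B r)).toReal -
        (intensity lam (B r)).toReal))) := by
  have hind : iIndepFun (fun r => pointCount T (B r)) μ := by
    have e := Fintype.equivFin ι
    have := hT.indep_pointCount _ (B ∘ e.symm) (fun r => hB _)
      fun r r' h => hBd (e.symm.injective.ne h)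
    have := this.precomp e.injective
    simpa [Function.comp_def] using this
  have haem : ∀ r, AEMeasurable (pointCount T (B r)) μ := fun r =>
    (hT.hasLaw_pointCount _ (hB r) (hBf r)).aemeasurable
  have h1 : ∀ r, ∫⁻ ω, (c r : ℝ≥0∞) ^ (pointCount T (B r) ω).toNat ∂μ =
      ENNReal.ofReal (Real.exp (c r * (intensity lam (B r)).toReal -
        (intensity lam (B r)).toReal)) := by
    intro r
    have h := hT.hasLaw_pointCount _ (hB r) (hBf r)
    have h2 := lintegral_map' (μ := μ) (f := fun x : ℕ∞ => (c r : ℝ≥0∞) ^ x.toNat)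
      (measurable_of_countable _).aemeasurable h.aemeasurable
    rw [← h2, h.map_eq, lintegral_map (measurable_of_countable _) (measurable_of_countable _)]
    simp only [ENat.toNat_natCast]
    rw [lintegral_pow_poissonMeasure]
    rfl
  have hind' := hind.comp (fun r (x : ℕ∞) => (c r : ℝ≥0∞) ^ x.toNat)
    (fun r => measurable_of_countable _)
  have haem' : ∀ r, AEMeasurable (fun ω => (c r : ℝ≥0∞) ^ (pointCount T (B r) ω).toNat) μ :=
    fun r => (measurable_of_countable fun x : ℕ∞ => (c r : ℝ≥0∞) ^ x.toNat).comp_aemeasurable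
      (haem r)
  have hprod := lintegral_prod_eq_prod_lintegral_of_indepFun Finset.univ _
    (hind'.congr fun r => (haem' r).ae_eq_mk) fun r => (haem' r).measurable_mk
  have hae : ∀ᵐ ω ∂μ, ∀ r, (c r : ℝ≥0∞) ^ (pointCount T (B r) ω).toNat = (haem' r).mk _ ω :=
    ae_all_iff.2 fun r => (haem' r).ae_eq_mk
  rw [Real.exp_sum, ENNReal.ofReal_prod_of_nonneg fun _ _ => (Real.exp_pos _).le]
  simp_rw [← h1]
  rw [lintegral_congr_ae (hae.mono fun ω hω => Finset.prod_congr rfl fun r _ => hω r), hprod]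
  exact Finset.prod_congr rfl fun r _ => lintegral_congr_ae (haem' r).ae_eq_mk.symm

theorem IsPoissonProcess.lintegral_finprod_upTo_simpleFunc [IsProbabilityMeasure μ]
    (hT : IsPoissonProcess μ lam T) (t : ℝ≥0) (f : SimpleFunc ℝ≥0 ℝ≥0∞) (hf : ∀ s, f s ≤ 1) :
    ∫⁻ ω, ∏ᶠ i, upTo t f (T i ω) ∂μ =
      ENNReal.ofReal (Real.exp ((∫⁻ τ, f τ ∂(intensity lam).restrict (Set.Iic t)).toReal -
        ((intensity lam).restrict (Set.Iic t)).real Set.univ)) := by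
  classical
  have hlt : ∀ c ∈ f.range, c ≠ ∞ := by
    intro c hc
    obtain ⟨s, rfl⟩ := SimpleFunc.mem_range.1 hc
    exact ne_top_of_le_ne_top ENNReal.one_ne_top (hf s)
  have hBf (c : ℝ≥0∞) : intensity lam (f ⁻¹' {c} ∩ Set.Iic t) < ∞ :=
    (measure_mono Set.inter_subset_right).trans_lt (hT.intensity_lt_top t)
  have key := hT.lintegral_prod_pointCount (fun c : f.range => f ⁻¹' {c.1} ∩ Set.Iic t)
    (fun c => (f.measurableSet_fiber _).inter measurableSet_Iic)
    (fun c c' h => Disjoint.mono Set.inter_subset_left Set.inter_subset_left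
      (Disjoint.preimage _ (Set.disjoint_singleton.2 (Subtype.coe_injective.ne h))))
    (fun c => hBf c) (fun c => c.1.toNNReal)
  have hmeas (c : ℝ≥0∞) : (intensity lam).restrict (Set.Iic t) (f ⁻¹' {c}) =
      intensity lam (f ⁻¹' {c} ∩ Set.Iic t) := Measure.restrict_apply (f.measurableSet_fiber _)
  convert! key using 1
  · refine lintegral_congr_ae ?_
    filter_upwards [hT.ae_finite t] with ω hω
    -- Grouping the points by the value of `f` turns the product into powers c^(number of points in
    -- the fibre of c).
    rw [finprod_upTo hω, Finset.prod_coe_sort f.range fun c =>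
      (c.toNNReal : ℝ≥0∞) ^ (pointCount T (f ⁻¹' {c} ∩ Set.Iic t) ω).toNat,
      ← Finset.prod_fiberwise_of_maps_to (t := f.range) (g := fun i => f (T i ω).toNNReal)
      fun i _ => f.mem_range_self _]
    refine Finset.prod_congr rfl fun c hc => ?_
    rw [Finset.prod_congr rfl (g := fun _ => c) fun i hi => (Finset.mem_filter.1 hi).2,
      Finset.prod_const, ENNReal.coe_toNNReal (hlt c hc)]
    congr 1
    have : {i : ℕ | ∃ s ∈ f ⁻¹' {c} ∩ Set.Iic t, T i ω = (s : ℝ≥0∞)} =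
        ({i ∈ hω.toFinset | f (T i ω).toNNReal = c} : Finset ℕ) := by
      rw [setOf_exists_mem_eq_coe t _ _ Set.inter_subset_right]
      ext i
      simp only [Set.mem_inter_iff, Set.mem_preimage, Set.mem_singleton_iff, Set.mem_Iic,
        Set.mem_ofPred_eq, Finset.coe_filter, Set.Finite.mem_toFinset]
      exact ⟨fun h => ⟨h.1, h.2.1⟩, fun h => ⟨h.1, h.2, ENNReal.toNNReal_mono ENNReal.coe_ne_top h.1⟩⟩
    rw [pointCount, this, Set.encard_coe_eq_coe_finsetCard, ENat.toNat_natCast]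
  · congr 2
    rw [Finset.sum_coe_sort f.range fun c => (c.toNNReal : ℝ) *
      (intensity lam (f ⁻¹' {c} ∩ Set.Iic t)).toReal -
      (intensity lam (f ⁻¹' {c} ∩ Set.Iic t)).toReal, Finset.sum_sub_distrib,
      SimpleFunc.lintegral_eq_lintegral, SimpleFunc.lintegral, ENNReal.toReal_sum, measureReal_def,
      ← SimpleFunc.sum_range_measure_preimage_singleton f, ENNReal.toReal_sum]
    · simp_rw [hmeas, ENNReal.toReal_mul]
      rfl
    · intro c _; rw [hmeas]; exact (hBf c).ne
    · intro c hc; rw [hmeas]; exact ENNReal.mul_ne_top (hlt c hc) (hBf c).ne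

/-- The Laplace functional of a Poisson process. -/
theorem IsPoissonProcess.lintegral_finprod_upTo [IsProbabilityMeasure μ]
    (hT : IsPoissonProcess μ lam T) (t : ℝ≥0) {f : ℝ≥0 → ℝ≥0∞} (hfm : Measurable f)
    (hf : ∀ s, f s ≤ 1) :
    ∫⁻ ω, ∏ᶠ i, upTo t f (T i ω) ∂μ =
      ENNReal.ofReal (Real.exp ((∫⁻ τ, f τ ∂(intensity lam).restrict (Set.Iic t)).toReal -
        ((intensity lam).restrict (Set.Iic t)).real Set.univ)) := by
  -- Simple functions approximate `f` from below; since all are at most 1, dominated convergence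
  -- passes both sides to the limit.
  have hle (m : ℕ) (s : ℝ≥0) : SimpleFunc.eapprox f m s ≤ f s := by
    rw [← SimpleFunc.iSup_eapprox_apply hfm s]
    exact le_iSup (fun m => SimpleFunc.eapprox f m s) m
  have hf' (m : ℕ) (s : ℝ≥0) : SimpleFunc.eapprox f m s ≤ 1 := (hle m s).trans (hf s)
  have hlim (s : ℝ≥0) : Tendsto (fun m => SimpleFunc.eapprox f m s) atTop (𝓝 (f s)) := by
    rw [← SimpleFunc.iSup_eapprox_apply hfm s]
    exact tendsto_atTop_iSup fun m m' h => SimpleFunc.monotone_eapprox f h s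
  have : IsFiniteMeasure ((intensity lam).restrict (Set.Iic t)) :=
    ⟨by simpa using hT.intensity_lt_top t⟩
  have hone : ∫⁻ _, (1 : ℝ≥0∞) ∂(intensity lam).restrict (Set.Iic t) ≠ ∞ := by
    rw [lintegral_one]; exact measure_ne_top _ _
  have hR : Tendsto (fun m => ∫⁻ τ, SimpleFunc.eapprox f m τ ∂(intensity lam).restrict (Set.Iic t))
      atTop (𝓝 (∫⁻ τ, f τ ∂(intensity lam).restrict (Set.Iic t))) :=
    tendsto_lintegral_of_dominated_convergence (fun _ => 1) (fun m => SimpleFunc.measurable _)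
      (fun m => Eventually.of_forall (hf' m)) hone (Eventually.of_forall hlim)
  have hR' := (ENNReal.tendsto_toReal (ne_top_of_le_ne_top hone (lintegral_mono hf))).comp hR
  have hprod {g : ℝ≥0 → ℝ≥0∞} (hg : ∀ s, g s ≤ 1) (hgm : Measurable g) :
      AEMeasurable (fun ω => ∏ᶠ i, upTo t g (T i ω)) μ :=
    aemeasurable_of_tendsto_metrizable_ae atTop
      (fun m => (Finset.measurable_prod (Finset.range m) fun i _ =>
        (measurable_upTo t hgm).comp (hT.measurable i)).aemeasurable)
      ((hT.ae_finite t).mono fun ω hω => tendsto_prod_upTo hω g)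
  have hL : Tendsto (fun m => ∫⁻ ω, ∏ᶠ i, upTo t (SimpleFunc.eapprox f m) (T i ω) ∂μ)
      atTop (𝓝 (∫⁻ ω, ∏ᶠ i, upTo t f (T i ω) ∂μ)) := by
    refine tendsto_lintegral_of_dominated_convergence' (fun _ => 1)
      (fun m => hprod (hf' m) (SimpleFunc.measurable _))
      (fun m => ?_) (by simp) ?_
    · filter_upwards [hT.ae_finite t] with ω hω
      rw [finprod_upTo hω]
      exact Finset.prod_le_one' fun i _ => hf' m _
    · filter_upwards [hT.ae_finite t] with ω hω
      simp_rw [finprod_upTo hω]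
      exact ENNReal.tendsto_finsetProd_of_ne_top _ (fun i _ => hlim _)
        (fun i _ => ne_top_of_le_ne_top ENNReal.one_ne_top (hf _))
  refine tendsto_nhds_unique hL ?_
  simp_rw [fun m => hT.lintegral_finprod_upTo_simpleFunc t (SimpleFunc.eapprox f m) (hf' m)]
  exact ENNReal.tendsto_ofReal ((Real.continuous_exp.tendsto _).comp (hR'.sub_const _))

end PoissonProcess

/-- Used for sums and products whose number of terms is a random batch size. -/
theorem measurable_apply_index {α β : Type*} {mα : MeasurableSpace α} {mβ : MeasurableSpace β}
    {h : α → ℕ} (hh : Measurable h) {g : ℕ → α → β} (hg : ∀ n, Measurable (g n)) :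
    Measurable fun x => g (h x) x :=
  (measurable_from_prod_countable_right (f := fun p : ℕ × α => g p.1 p.2) hg).comp
    (hh.prodMk measurable_id)

/-! ### The contribution of a single customer -/

section Weight

variable {Ω : Type*} {J : ℕ}

/-- The contribution of a customer at location `o` to the monomial of the occupancy. -/
def weight (z : Fin J → ℝ≥0) (o : Option (Fin J)) : ℝ≥0 := o.elim 1 z

theorem monom_batchOccupancy (z : Fin J → ℝ≥0) (S : ℕ → Ω → Fin J → ℕ)
    (X : ℕ → Fin J → ℕ → ℝ≥0 → Ω → Option (Fin J)) (i : ℕ) (s : ℝ≥0) (ω : Ω) :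
    monom z (batchOccupancy S X i s ω) =
      ∏ j, ∏ ℓ ∈ Finset.range (S i ω j), weight z (X i j ℓ s ω) := by
  have h : batchOccupancy S X i s ω = ∑ j : Fin J, ∑ ℓ ∈ Finset.range (S i ω j),
      fun k => if X i j ℓ s ω = some k then 1 else 0 := by
    ext k; simp [batchOccupancy, Finset.sum_apply]
  rw [h, monom_sum]
  simp_rw [monom_sum]
  refine Finset.prod_congr rfl fun j _ => Finset.prod_congr rfl fun ℓ _ => ?_
  cases hX : X i j ℓ s ω with
  | none => simp [monom, weight]
  | some k => simp [monom, weight, pow_ite, Finset.prod_ite_eq]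

theorem lintegral_comp_option [MeasurableSpace Ω] (μ : Measure Ω) {Y : Ω → Option (Fin J)}
    (hY : Measurable[_, ⊤] Y) (f : Option (Fin J) → ℝ≥0∞) :
    ∫⁻ ω, f (Y ω) ∂μ = ∑ o, f o * μ {ω | Y ω = o} := by
  let _ : MeasurableSpace (Option (Fin J)) := ⊤
  have : MeasurableSingletonClass (Option (Fin J)) := ⟨fun _ => trivial⟩
  rw [← lintegral_map (μ := μ) (f := f) measurable_from_top hY, lintegral_fintype]
  exact Finset.sum_congr rfl fun o _ => by rw [Measure.map_apply hY (measurableSet_singleton o)]; rfl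

/-- The probability of being outside is not prescribed, but it is what the queues leave of the total
mass, so it agrees as well. -/
theorem lintegral_weight_eq [MeasurableSpace Ω] {μ : Measure Ω} [IsProbabilityMeasure μ]
    {Y Y' : Ω → Option (Fin J)} (hY : Measurable[_, ⊤] Y) (hY' : Measurable[_, ⊤] Y')
    (h : ∀ k, μ {ω | Y ω = some k} = μ {ω | Y' ω = some k}) (z : Fin J → ℝ≥0) :
    ∫⁻ ω, (weight z (Y ω) : ℝ≥0∞) ∂μ = ∫⁻ ω, (weight z (Y' ω) : ℝ≥0∞) ∂μ := by
  have h1 := lintegral_comp_option μ hY fun _ => 1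
  have h2 := lintegral_comp_option μ hY' fun _ => 1
  rw [lintegral_comp_option μ hY fun o => (weight z o : ℝ≥0∞),
    lintegral_comp_option μ hY' fun o => (weight z o : ℝ≥0∞)]
  simp only [Fintype.sum_option, h, one_mul] at h1 h2 ⊢
  congr 2
  refine (ENNReal.add_left_inj ?_).1 (h1.symm.trans h2)
  exact ENNReal.sum_ne_top.2 fun k _ => measure_ne_top _ _

end Weight

/-! ### Independence of the batches and freezing of the arrival times -/

section Network

variable {Ω : Type*} {J : ℕ} {T : ℕ → Ω → ℝ≥0∞} {S : ℕ → Ω → Fin J → ℕ}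
  {X : ℕ → Fin J → ℕ → ℝ≥0 → Ω → Option (Fin J)}

/-- The σ-algebra generated by the sources of randomness in `B`. -/
@[reducible] def sourcesSigma (T : ℕ → Ω → ℝ≥0∞) (S : ℕ → Ω → Fin J → ℕ)
    (X : ℕ → Fin J → ℕ → ℝ≥0 → Ω → Option (Fin J)) (B : Set (Source J)) : MeasurableSpace Ω :=
  ⨆ a ∈ B, sourceSigma T S X a

theorem sourceSigma_le_sourcesSigma {B : Set (Source J)} {a : Source J} (ha : a ∈ B) :
    sourceSigma T S X a ≤ sourcesSigma T S X B :=
  le_iSup₂_of_le (f := fun a _ => sourceSigma T S X a) a ha le_rfl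

theorem measurable_arrival {B : Set (Source J)} (hB : Source.arrivals ∈ B) (i : ℕ) :
    Measurable[sourcesSigma T S X B] (T i) :=
  measurable_iff_comap_le.2 ((le_iSup (fun i => MeasurableSpace.comap (T i) inferInstance) i).trans
    (sourceSigma_le_sourcesSigma (S := S) (X := X) hB))

theorem measurable_batchSize {B : Set (Source J)} {i : ℕ} (hB : Source.batch i ∈ B) :
    Measurable[sourcesSigma T S X B] (S i) :=
  measurable_iff_comap_le.2 (sourceSigma_le_sourcesSigma (T := T) (X := X) hB)

theorem measurable_comp_routeSigma {β : Type*} [MeasurableSpace β] (Y : ℝ≥0 → Ω → Option (Fin J))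
    (s : ℝ≥0) (f : Option (Fin J) → β) : Measurable[routeSigma Y] fun ω => f (Y s ω) :=
  (@measurable_from_top _ _ _ f).comp
    (measurable_iff_comap_le.2 (le_iSup (fun s => MeasurableSpace.comap (Y s) ⊤) s))

theorem measurable_comp_route {β : Type*} [MeasurableSpace β] {B : Set (Source J)} {i : ℕ}
    {j : Fin J} {ℓ : ℕ} (hB : Source.route i j ℓ ∈ B) (s : ℝ≥0) (f : Option (Fin J) → β) :
    Measurable[sourcesSigma T S X B] fun ω => f (X i j ℓ s ω) :=
  (measurable_comp_routeSigma (X i j ℓ) s f).mono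
    (sourceSigma_le_sourcesSigma (T := T) (S := S) hB) le_rfl

/-- The customers of batch `i` in the different queues at time `t`. -/
noncomputable def batchCount (T : ℕ → Ω → ℝ≥0∞) (S : ℕ → Ω → Fin J → ℕ)
    (X : ℕ → Fin J → ℕ → ℝ≥0 → Ω → Option (Fin J)) (t : ℝ≥0) (i : ℕ) (ω : Ω) : Fin J → ℕ :=
  if T i ω ≤ t then batchOccupancy S X i (t - (T i ω).toNNReal) ω else 0

variable [mΩ : MeasurableSpace Ω] {μ : Measure Ω} {lam : ℝ≥0 → ℝ≥0}
  {q : Fin J → Fin J → ℝ≥0 → ℝ}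

theorem IsNetwork.sourceSigma_le (h : IsNetwork μ lam q T S X) (a : Source J) :
    sourceSigma T S X a ≤ mΩ := by
  cases a with
  | arrivals => exact iSup_le fun i => (h.poisson.measurable i).comap_le
  | batch i => exact (h.measurable_batch i).comap_le
  | route i j ℓ =>
    exact iSup_le fun s => @Measurable.comap_le _ _ mΩ ⊤ _ (h.measurable_route i j ℓ s)

theorem IsNetwork.sourcesSigma_le (h : IsNetwork μ lam q T S X) (B : Set (Source J)) :
    sourcesSigma T S X B ≤ mΩ :=
  iSup₂_le fun a _ => h.sourceSigma_le a

theorem IsNetwork.indep_sourcesSigma (h : IsNetwork μ lam q T S X) {A B : Set (Source J)}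
    (hAB : Disjoint A B) : Indep (sourcesSigma T S X A) (sourcesSigma T S X B) μ :=
  indep_iSup_of_disjoint h.sourceSigma_le h.indep hAB

/-- Numbers of customers of one batch are jointly measurable in time and in the randomness of the
size and the routes of that batch. -/
theorem IsNetwork.measurable_batchOccupancy (h : IsNetwork μ lam q T S X) {i : ℕ}
    {B : Set (Source J)} (hS : .batch i ∈ B) (hX : ∀ j ℓ, .route i j ℓ ∈ B) :
    Measurable[MeasurableSpace.prod inferInstance (sourcesSigma T S X B)]
      fun p : ℝ≥0 × Ω => batchOccupancy S X i p.1 p.2 := by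
  refine @measurable_pi_lambda _ _ _ (_) _ _ fun k => ?_
  refine @Finset.measurable_sum _ _ _ _ _ _ (_) _ _ fun j _ => ?_
  refine @measurable_apply_index _ _ (_) _ (fun p : ℝ≥0 × Ω => S i p.2 j)
    ((measurable_pi_apply j).comp
      ((measurable_batchSize hS).comp (@measurable_snd _ _ _ (sourcesSigma T S X B))))
    (fun n p => ∑ ℓ ∈ Finset.range n, if X i j ℓ p.1 p.2 = some k then 1 else 0) fun n => ?_
  refine @Finset.measurable_sum _ _ _ _ _ _ (_) _ _ fun ℓ _ => ?_
  have hjm : Measurable[MeasurableSpace.prod inferInstance (sourcesSigma T S X B), ⊤]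
      fun p : ℝ≥0 × Ω => X i j ℓ p.1 p.2 :=
    (h.jointly_measurable_route i j ℓ).mono (sup_le_sup le_rfl (MeasurableSpace.comap_mono
      (sourceSigma_le_sourcesSigma (T := T) (S := S) (hX j ℓ)))) le_rfl
  exact (@measurable_from_top _ _ _ fun o : Option (Fin J) => if o = some k then 1 else 0).comp hjm

theorem IsNetwork.measurable_batchOccupancy_prod (h : IsNetwork μ lam q T S X) (i : ℕ) :
    Measurable fun p : ℝ≥0 × Ω => batchOccupancy S X i p.1 p.2 :=
  (h.measurable_batchOccupancy (B := Set.univ) trivial fun _ _ => trivial).mono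
    (sup_le_sup le_rfl (MeasurableSpace.comap_mono (h.sourcesSigma_le _))) le_rfl

theorem IsNetwork.measurable_batchCount (h : IsNetwork μ lam q T S X) (t : ℝ≥0) (i : ℕ) :
    Measurable (batchCount T S X t i) := by
  have hs : MeasurableSet {ω | T i ω ≤ t} :=
    measurableSet_le (h.poisson.measurable i) measurable_const
  have hpair : Measurable fun ω => (t - (T i ω).toNNReal, ω) :=
    (measurable_const.sub (h.poisson.measurable i).ennreal_toNNReal).prodMk measurable_id
  have hocc := (h.measurable_batchOccupancy_prod i).comp hpair
  have hite : batchCount T S X t i = fun ω =>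
      if T i ω ≤ t then batchOccupancy S X i (t - (T i ω).toNNReal) ω else 0 := rfl
  rw [hite]
  exact Measurable.ite hs hocc (measurable_const (a := 0))

variable [IsProbabilityMeasure μ]

/-- The joint generating function of the numbers of customers of different batches. -/
theorem IsNetwork.lintegral_prod_monom_batchOccupancy_aux (h : IsNetwork μ lam q T S X)
    (z : Fin J → ℝ≥0) (b : ℕ) (I : Finset ℕ) (s : ℕ → ℝ≥0) :
    ∫⁻ ω, ∏ i ∈ I, (monom z (batchOccupancy S X i (s i) ω) : ℝ≥0∞) ∂μ =
      ∏ i ∈ I, ∫⁻ ω, ∏ j, (∫⁻ ω', (weight z (X b j 0 (s i) ω') : ℝ≥0∞) ∂μ) ^ S b ω j ∂μ := by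
  -- Customer 0 of batch b serves as reference: the mean weight depends only on the entry queue and
  -- the age of the batch.
  set r : Fin J → ℝ≥0 → ℝ≥0∞ := fun j s => ∫⁻ ω', (weight z (X b j 0 s ω') : ℝ≥0∞) ∂μ with hr
  let A : Set (Source J) := Set.range Source.batch
  let B : Set (Source J) := {a | ∃ i j ℓ, a = Source.route i j ℓ}
  have hAB : Disjoint A B := by
    rw [Set.disjoint_left]
    rintro _ ⟨i, rfl⟩ ⟨_, _, _, h⟩
    cases h
  have hB (i : ℕ) (j : Fin J) (ℓ : ℕ) : Source.route i j ℓ ∈ B := ⟨i, j, ℓ, rfl⟩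
  let U : Ω → ℕ → Fin J → ℕ := fun ω i => S i ω
  have hU : Measurable U := measurable_pi_lambda _ h.measurable_batch
  have hUA : MeasurableSpace.comap U inferInstance ≤ sourcesSigma T S X A := by
    rw [← measurable_iff_comap_le]
    exact @measurable_pi_lambda _ _ _ (_) _ _ fun i => measurable_batchSize ⟨i, rfl⟩
  have hind := indep_of_indep_of_le_left (h.indep_sourcesSigma hAB) hUA
  let F : (ℕ → Fin J → ℕ) × Ω → ℝ≥0∞ := fun p =>
    ∏ i ∈ I, ∏ j, ∏ ℓ ∈ Finset.range (p.1 i j), (weight z (X i j ℓ (s i) p.2) : ℝ≥0∞)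
  have hF : Measurable[MeasurableSpace.prod inferInstance (sourcesSigma T S X B)] F := by
    refine @Finset.measurable_prod _ _ _ _ _ _ (_) _ _ fun i _ => ?_
    refine @Finset.measurable_prod _ _ _ _ _ _ (_) _ _ fun j _ => ?_
    refine @measurable_apply_index _ _ (_) _ (fun p : (ℕ → Fin J → ℕ) × Ω => p.1 i j)
      ((measurable_pi_apply j).comp ((measurable_pi_apply i).comp (@measurable_fst _ _ _ (sourcesSigma T S X B))))
      (fun n p => ∏ ℓ ∈ Finset.range n, (weight z (X i j ℓ (s i) p.2) : ℝ≥0∞)) fun n => ?_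
    refine @Finset.measurable_prod _ _ _ _ _ _ (_) _ _ fun ℓ _ => ?_
    exact (measurable_comp_route (hB i j ℓ) (s i) fun o => (weight z o : ℝ≥0∞)).comp (@measurable_snd _ _ _ (sourcesSigma T S X B))
  have hweight (i : ℕ) (j : Fin J) (ℓ : ℕ) (s : ℝ≥0) :
      ∫⁻ ω', (weight z (X i j ℓ s ω') : ℝ≥0∞) ∂μ = r j s := by
    refine lintegral_weight_eq (h.measurable_route _ _ _ _) (h.measurable_route _ _ _ _)
      (fun k => ?_) z
    rw [← ENNReal.toReal_eq_toReal_iff' (measure_ne_top _ _) (measure_ne_top _ _)]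
    exact (h.route_law i j ℓ k s).trans (h.route_law b j 0 k s).symm
  -- With the sizes frozen at σ, the product runs over finitely many distinct, hence independent,
  -- routes.
  have hinner (σ : ℕ → Fin J → ℕ) :
      ∫⁻ ω', F (σ, ω') ∂μ = ∏ i ∈ I, ∏ j, r j (s i) ^ σ i j := by
    let a : ((_ : ℕ) × (_ : Fin J) × ℕ) → Ω → ℝ≥0∞ :=
      fun p ω => weight z (X p.1 p.2.1 p.2.2 (s p.1) ω)
    have ha (p) : Measurable (a p) :=
      (@measurable_from_top _ _ _ fun o : Option (Fin J) => (weight z o : ℝ≥0∞)).comp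
        (h.measurable_route p.1 p.2.1 p.2.2 (s p.1))
    have haind : iIndepFun a μ := by
      rw [iIndepFun_iff_iIndep]
      have hinj : Function.Injective
          fun p : ((_ : ℕ) × (_ : Fin J) × ℕ) => Source.route p.1 p.2.1 p.2.2 := by
        rintro ⟨i, j, ℓ⟩ ⟨i', j', ℓ'⟩ h
        simp only [Source.route.injEq] at h
        obtain ⟨rfl, rfl, rfl⟩ := h
        rfl
      refine iIndep_of_iIndep_of_le (h.indep.precomp hinj) fun p => ?_
      rw [← measurable_iff_comap_le]
      exact measurable_comp_routeSigma (X p.1 p.2.1 p.2.2) (s p.1) fun o => (weight z o : ℝ≥0∞)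
    have hp := lintegral_prod_eq_prod_lintegral_of_indepFun
      (I.sigma fun i => Finset.univ.sigma fun j => Finset.range (σ i j)) a haind ha
    simp only [Finset.prod_sigma, a, hweight, Finset.prod_const, Finset.card_range] at hp
    exact hp
  have hfreeze := lintegral_comp_prodMk_of_indep hU
    (h.sourcesSigma_le B) hind hF
  simp_rw [monom_batchOccupancy, ENNReal.ofNNReal_finsetProd]
  refine hfreeze.trans ?_
  simp_rw [hinner]
  have hSind : iIndepFun S μ := by
    rw [iIndepFun_iff_iIndep]
    exact h.indep.precomp (g := Source.batch) fun i i' h => by simpa using h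
  have hp := lintegral_prod_eq_prod_lintegral_of_indepFun I _
    (hSind.comp (fun i σ => ∏ j, r j (s i) ^ σ j) fun i => measurable_of_countable _)
    (fun i => (measurable_of_countable _).comp (h.measurable_batch i))
  refine hp.trans (Finset.prod_congr rfl fun i _ => ?_)
  exact (((h.identDistrib_batch i).trans (h.identDistrib_batch b).symm).comp
    (u := fun σ => ∏ j, r j (s i) ^ σ j) (measurable_of_countable _)).lintegral_eq

/-- The factors in the auxiliary lemma depend on i only through `s i`; its case I = {b} turns each
of them back into a generating function of batch b. -/
theorem IsNetwork.lintegral_prod_monom_batchOccupancy (h : IsNetwork μ lam q T S X)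
    (z : Fin J → ℝ≥0) (b : ℕ) (I : Finset ℕ) (s : ℕ → ℝ≥0) :
    ∫⁻ ω, ∏ i ∈ I, (monom z (batchOccupancy S X i (s i) ω) : ℝ≥0∞) ∂μ =
      ∏ i ∈ I, ∫⁻ ω, (monom z (batchOccupancy S X b (s i) ω) : ℝ≥0∞) ∂μ := by
  rw [h.lintegral_prod_monom_batchOccupancy_aux z b I s]
  refine Finset.prod_congr rfl fun i _ => ?_
  have := h.lintegral_prod_monom_batchOccupancy_aux z b {b} fun _ => s i
  simpa using this.symm

/-- Once the arrival times are frozen, the ages of the batches are deterministic and the product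
factors; batches arriving after t contribute 1. -/
theorem IsNetwork.lintegral_prod_monom_batchCount (h : IsNetwork μ lam q T S X)
    (z : Fin J → ℝ≥0) (b : ℕ) (t : ℝ≥0) (m : ℕ) :
    ∫⁻ ω, ∏ i ∈ Finset.range m, (monom z (batchCount T S X t i ω) : ℝ≥0∞) ∂μ =
      ∫⁻ ω, ∏ i ∈ Finset.range m, upTo t
        (fun τ => ∫⁻ ω', (monom z (batchOccupancy S X b (t - τ) ω') : ℝ≥0∞) ∂μ) (T i ω) ∂μ := by
  let B : Set (Source J) := {Source.arrivals}ᶜ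
  let U : Ω → ℕ → ℝ≥0∞ := fun ω i => T i ω
  have hU : Measurable U := measurable_pi_lambda _ h.poisson.measurable
  have hUA : MeasurableSpace.comap U inferInstance ≤ sourcesSigma T S X {Source.arrivals} := by
    rw [← measurable_iff_comap_le]
    exact @measurable_pi_lambda _ _ _ (_) _ _ fun i => measurable_arrival (Set.mem_singleton _) i
  have hind := indep_of_indep_of_le_left
    (h.indep_sourcesSigma (B := B) disjoint_compl_right) hUA
  let F : (ℕ → ℝ≥0∞) × Ω → ℝ≥0∞ := fun p => ∏ i ∈ Finset.range m,
    if p.1 i ≤ t then (monom z (batchOccupancy S X i (t - (p.1 i).toNNReal) p.2) : ℝ≥0∞) else 1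
  have hF : Measurable[MeasurableSpace.prod inferInstance (sourcesSigma T S X B)] F := by
    refine @Finset.measurable_prod _ _ _ _ _ _ (_) _ _ fun i _ => ?_
    have hfst : Measurable[MeasurableSpace.prod inferInstance (sourcesSigma T S X B)]
        fun p : (ℕ → ℝ≥0∞) × Ω => p.1 i :=
      (measurable_pi_apply i).comp (@measurable_fst _ _ _ (sourcesSigma T S X B))
    have hset : MeasurableSet[MeasurableSpace.prod inferInstance (sourcesSigma T S X B)]
        {p : (ℕ → ℝ≥0∞) × Ω | p.1 i ≤ t} := hfst (measurableSet_Iic (a := (t : ℝ≥0∞)))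
    refine @Measurable.ite _ _ (_) _ _ _ _ _ hset ?_ (@measurable_const _ _ _ (_) _)
    have hocc := h.measurable_batchOccupancy (i := i) (B := B) (by simp [B])
      fun j ℓ => by simp [B]
    have hpair : @Measurable _ _ (MeasurableSpace.prod inferInstance (sourcesSigma T S X B))
        (MeasurableSpace.prod inferInstance (sourcesSigma T S X B))
        fun p : (ℕ → ℝ≥0∞) × Ω => (t - (p.1 i).toNNReal, p.2) :=
      @Measurable.prodMk _ (_) _ _ _ (sourcesSigma T S X B) _ _
        ((measurable_const.sub ENNReal.measurable_toNNReal).comp hfst) (@measurable_snd _ _ _ (sourcesSigma T S X B))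
    have hcomp := hocc.comp hpair
    exact (measurable_of_countable fun x : Fin J → ℕ => (monom z x : ℝ≥0∞)).comp hcomp
  have hfreeze := lintegral_comp_prodMk_of_indep hU
    (h.sourcesSigma_le B) hind hF
  refine Eq.trans (lintegral_congr fun ω => Finset.prod_congr rfl fun i _ => ?_)
    (hfreeze.trans (lintegral_congr fun ω => ?_))
  · simp only [batchCount, U]
    split_ifs <;> simp [monom_zero]
  · have := h.lintegral_prod_monom_batchOccupancy z b {i ∈ Finset.range m | T i ω ≤ t}
      fun i => t - (T i ω).toNNReal
    simp only [Finset.prod_filter] at this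
    exact this

end Network

/-! ### The occupancy as a sum over batches, and its law -/

open Filter Topology

variable {Ω : Type*} {J : ℕ} {T : ℕ → Ω → ℝ≥0∞} {S : ℕ → Ω → Fin J → ℕ}
  {X : ℕ → Fin J → ℕ → ℝ≥0 → Ω → Option (Fin J)}

theorem batchCount_eq_zero {t : ℝ≥0} {i : ℕ} {ω : Ω} (h : ¬ T i ω ≤ t) :
    batchCount T S X t i ω = 0 := if_neg h

/-- The set of counted customers is finite, and it is counted batch by batch and entry queue by
entry queue. -/
theorem occupancy_eq_sum {t : ℝ≥0} {ω : Ω} (hω : {i | T i ω ≤ t}.Finite) (k : Fin J) :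
    occupancy T S X t ω k = ((∑ i ∈ hω.toFinset, batchCount T S X t i ω k : ℕ) : ℕ∞) := by
  classical
  let R : Finset ((_ : ℕ) × (_ : Fin J) × ℕ) :=
    (hω.toFinset.sigma fun i => Finset.univ.sigma fun j => Finset.range (S i ω j)).filter
      fun p => X p.1 p.2.1 p.2.2 (t - (T p.1 ω).toNNReal) ω = some k
  have hinj : Function.Injective
      fun p : (_ : ℕ) × (_ : Fin J) × ℕ => ((p.1, p.2.1, p.2.2) : ℕ × Fin J × ℕ) := by
    rintro ⟨i, j, ℓ⟩ ⟨i', j', ℓ'⟩ h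
    simp only [Prod.mk.injEq] at h
    obtain ⟨rfl, rfl, rfl⟩ := h
    rfl
  have hset : {c : ℕ × Fin J × ℕ | ∃ τ : ℝ≥0, T c.1 ω = (τ : ℝ≥0∞) ∧ τ ≤ t ∧
      c.2.2 < S c.1 ω c.2.1 ∧ X c.1 c.2.1 c.2.2 (t - τ) ω = some k} =
      (R.image fun p => ((p.1, p.2.1, p.2.2) : ℕ × Fin J × ℕ) : Finset _) := by
    ext ⟨i, j, ℓ⟩
    simp only [Set.mem_ofPred_eq, Finset.coe_image, Set.mem_image, Finset.mem_coe, R,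
      Finset.mem_filter, Finset.mem_sigma, Set.Finite.mem_toFinset, Finset.mem_univ, true_and,
      Finset.mem_range]
    constructor
    · rintro ⟨τ, hτ, hle, hℓ, hX⟩
      exact ⟨⟨i, j, ℓ⟩, ⟨⟨by rw [hτ]; exact ENNReal.coe_le_coe.2 hle, hℓ⟩, by simpa [hτ] using hX⟩,
        rfl⟩
    · rintro ⟨⟨i', j', ℓ'⟩, ⟨⟨hle, hℓ⟩, hX⟩, h⟩
      simp only [Prod.mk.injEq] at h
      obtain ⟨rfl, rfl, rfl⟩ := h
      refine ⟨_, (ENNReal.coe_toNNReal (ne_top_of_le_ne_top ENNReal.coe_ne_top hle)).symm,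
        ENNReal.toNNReal_mono ENNReal.coe_ne_top hle, hℓ, hX⟩
  rw [occupancy, hset, Set.encard_coe_eq_coe_finsetCard, Finset.card_image_of_injective _ hinj,
    Finset.card_filter, Finset.sum_sigma]
  congr 1
  refine Finset.sum_congr rfl fun i hi => ?_
  rw [batchCount, if_pos (by simpa using hi), Finset.sum_sigma]
  rfl

/-- The vector of the numbers of customers in the queues, as a sum over the batches. -/
noncomputable def totalCount (T : ℕ → Ω → ℝ≥0∞) (S : ℕ → Ω → Fin J → ℕ)
    (X : ℕ → Fin J → ℕ → ℝ≥0 → Ω → Option (Fin J)) (t : ℝ≥0) (ω : Ω) : Fin J → ℕ :=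
  ∑ᶠ i, batchCount T S X t i ω

theorem totalCount_eq_sum {t : ℝ≥0} {ω : Ω} (hω : {i | T i ω ≤ t}.Finite) :
    totalCount T S X t ω = ∑ i ∈ hω.toFinset, batchCount T S X t i ω := by
  refine finsum_eq_sum_of_support_subset _ fun i hi => ?_
  by_contra h
  exact hi (batchCount_eq_zero (by simpa using h))

theorem tendsto_sum_batchCount {t : ℝ≥0} {ω : Ω} (hω : {i | T i ω ≤ t}.Finite) :
    Tendsto (fun m => ∑ i ∈ Finset.range m, batchCount T S X t i ω) atTop
      (𝓝 (totalCount T S X t ω)) := by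
  rw [totalCount_eq_sum hω]
  obtain ⟨m, hm⟩ := hω.toFinset.exists_nat_subset_range
  refine tendsto_const_nhds.congr' ?_
  filter_upwards [eventually_ge_atTop m] with m' hm'
  refine Finset.sum_subset (hm.trans (Finset.range_subset_range.2 hm')) fun i _ hi => ?_
  exact batchCount_eq_zero (by simpa using hi)

variable [mΩ : MeasurableSpace Ω] {μ : Measure Ω} {lam : ℝ≥0 → ℝ≥0}
  {q : Fin J → Fin J → ℝ≥0 → ℝ}

theorem IsNetwork.aemeasurable_totalCount (h : IsNetwork μ lam q T S X) (t : ℝ≥0) :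
    AEMeasurable (totalCount T S X t) μ :=
  aemeasurable_of_tendsto_metrizable_ae atTop
    (fun m => (Finset.measurable_fun_sum (Finset.range m) fun i _ =>
      h.measurable_batchCount t i).aemeasurable)
    ((h.poisson.ae_finite t).mono fun _ hω => tendsto_sum_batchCount hω)

/-- The two events can differ only on the null set where infinitely many batches arrive by time t.
-/
theorem IsNetwork.occupancyPMF_eq (h : IsNetwork μ lam q T S X) (t : ℝ≥0) (n : Fin J → ℕ) :
    occupancyPMF μ T S X t n = (μ.map (totalCount T S X t) {n}).toReal := by
  rw [Measure.map_apply_of_aemeasurable (h.aemeasurable_totalCount t) (measurableSet_singleton n),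
    occupancyPMF, measureReal_def]
  congr 1
  refine measure_congr ?_
  filter_upwards [h.poisson.ae_finite t] with ω hω
  refine propext ?_
  change (∀ k, occupancy T S X t ω k = (n k : ℕ∞)) ↔ totalCount T S X t ω = n
  simp_rw [occupancy_eq_sum hω, totalCount_eq_sum hω, funext_iff, Finset.sum_apply, Nat.cast_inj]

/-- The expected numbers, for each vector `c`, of the batches that have arrived by time `t` and then
have `c k` customers in each queue `k`. -/
noncomputable def batchIntensity (μ : Measure Ω) (lam : ℝ≥0 → ℝ≥0) (S : ℕ → Ω → Fin J → ℕ)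
    (X : ℕ → Fin J → ℕ → ℝ≥0 → Ω → Option (Fin J)) (b : ℕ) (t : ℝ≥0) : Measure (Fin J → ℕ) :=
  (((intensity lam).restrict (Set.Iic t)).prod μ).map fun p => batchOccupancy S X b (t - p.1) p.2

theorem IsNetwork.measurable_batchOccupancy_sub (h : IsNetwork μ lam q T S X) (b : ℕ) (t : ℝ≥0) :
    Measurable fun p : ℝ≥0 × Ω => batchOccupancy S X b (t - p.1) p.2 := by
  have hpair : Measurable fun p : ℝ≥0 × Ω => (t - p.1, p.2) :=
    (measurable_const.sub measurable_fst).prodMk measurable_snd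
  have := (h.measurable_batchOccupancy_prod b).comp hpair
  exact this

theorem IsNetwork.isFiniteMeasure_intensity (h : IsNetwork μ lam q T S X) (t : ℝ≥0) :
    IsFiniteMeasure ((intensity lam).restrict (Set.Iic t)) :=
  ⟨by simpa using h.poisson.intensity_lt_top t⟩

variable [IsProbabilityMeasure μ]

theorem IsNetwork.lintegral_batchIntensity (h : IsNetwork μ lam q T S X) (b : ℕ) (t : ℝ≥0)
    (f : (Fin J → ℕ) → ℝ≥0∞) :
    ∫⁻ x, f x ∂(batchIntensity μ lam S X b t) =
      ∫⁻ τ, ∫⁻ ω, f (batchOccupancy S X b (t - τ) ω) ∂μ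
        ∂(intensity lam).restrict (Set.Iic t) := by
  have := h.isFiniteMeasure_intensity t
  have hm := h.measurable_batchOccupancy_sub b t
  rw [batchIntensity, lintegral_map (measurable_of_countable _) hm]
  exact lintegral_prod _ ((measurable_of_countable f).comp hm).aemeasurable

theorem IsNetwork.isFiniteMeasure_batchIntensity (h : IsNetwork μ lam q T S X) (b : ℕ) (t : ℝ≥0) :
    IsFiniteMeasure (batchIntensity μ lam S X b t) := by
  have := h.isFiniteMeasure_intensity t
  unfold batchIntensity
  infer_instance

/-- For the first m batches, freezing the arrival times equates the two means. As m grows, one side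
tends to the generating function of the total and the other to the Laplace functional at y. -/
theorem IsNetwork.lintegral_monom_totalCount (h : IsNetwork μ lam q T S X) (b : ℕ) (t : ℝ≥0)
    {z : Fin J → ℝ≥0} (hz : ∀ k, z k ≤ 1) :
    ∫⁻ ω, (monom z (totalCount T S X t ω) : ℝ≥0∞) ∂μ =
      ENNReal.ofReal (Real.exp ((∫⁻ x, (monom z x : ℝ≥0∞) ∂(batchIntensity μ lam S X b t)).toReal -
        (batchIntensity μ lam S X b t).real Set.univ)) := by
  have hfin := h.isFiniteMeasure_intensity t
  have hz' (x : Fin J → ℕ) : (monom z x : ℝ≥0∞) ≤ 1 := ENNReal.coe_le_one_iff.2 (monom_le_one hz x)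
  set y : ℝ≥0 → ℝ≥0∞ := fun τ => ∫⁻ ω, (monom z (batchOccupancy S X b (t - τ) ω) : ℝ≥0∞) ∂μ with hy
  have hy1 (τ : ℝ≥0) : y τ ≤ 1 := by
    refine (lintegral_mono fun ω => hz' _).trans ?_
    simp
  have hym : Measurable y := by
    have := (measurable_of_countable fun x : Fin J → ℕ => (monom z x : ℝ≥0∞)).comp
      (h.measurable_batchOccupancy_sub b t)
    exact this.lintegral_prod_right'
  -- Each mark has total probability 1, so ν has the mass of the intensity on [0, t].
  have huniv : (batchIntensity μ lam S X b t).real Set.univ =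
      ((intensity lam).restrict (Set.Iic t)).real Set.univ := by
    rw [measureReal_def, measureReal_def]
    congr 1
    simpa using h.lintegral_batchIntensity b t fun _ => 1
  rw [h.lintegral_batchIntensity b t fun x => (monom z x : ℝ≥0∞), huniv,
    ← h.poisson.lintegral_finprod_upTo t hym hy1]
  have hR : Tendsto (fun m => ∫⁻ ω, ∏ i ∈ Finset.range m, upTo t y (T i ω) ∂μ) atTop
      (𝓝 (∫⁻ ω, ∏ᶠ i, upTo t y (T i ω) ∂μ)) := by
    refine tendsto_lintegral_of_dominated_convergence (fun _ => 1) (fun m => ?_)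
      (fun m => Eventually.of_forall fun ω => ?_) (by simp)
      ((h.poisson.ae_finite t).mono fun ω hω => tendsto_prod_upTo hω y)
    · exact Finset.measurable_fun_prod _ fun i _ =>
        (measurable_upTo t hym).comp (h.poisson.measurable i)
    · exact Finset.prod_le_one' fun i _ => upTo_le_one t hy1 _
  have hL : Tendsto (fun m => ∫⁻ ω, ∏ i ∈ Finset.range m,
      (monom z (batchCount T S X t i ω) : ℝ≥0∞) ∂μ) atTop
      (𝓝 (∫⁻ ω, (monom z (totalCount T S X t ω) : ℝ≥0∞) ∂μ)) := by
    refine tendsto_lintegral_of_dominated_convergence (fun _ => 1) (fun m => ?_)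
      (fun m => Eventually.of_forall fun ω => ?_) (by simp)
      ((h.poisson.ae_finite t).mono fun ω hω => ?_)
    · exact Finset.measurable_fun_prod _ fun i _ =>
        (measurable_of_countable fun x : Fin J → ℕ => (monom z x : ℝ≥0∞)).comp
          (h.measurable_batchCount t i)
    · exact Finset.prod_le_one' fun i _ => hz' _
    · have := ((continuous_of_discreteTopology (f := fun x : Fin J → ℕ =>
        (monom z x : ℝ≥0∞))).tendsto _).comp (tendsto_sum_batchCount (S := S) (X := X) hω)
      simpa only [Function.comp_def, monom_sum, ENNReal.ofNNReal_finsetProd] using this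
  simp_rw [h.lintegral_prod_monom_batchCount z b t] at hL
  exact tendsto_nhds_unique hL hR

theorem IsNetwork.map_totalCount (h : IsNetwork μ lam q T S X) (b : ℕ) (t : ℝ≥0) :
    μ.map (totalCount T S X t) = compoundPoisson (batchIntensity μ lam S X b t) := by
  have := h.isFiniteMeasure_batchIntensity b t
  refine ext_of_lintegral_monom fun z hz => ?_
  rw [lintegral_monom_compoundPoisson z hz, ← h.lintegral_monom_totalCount b t hz]
  exact lintegral_map' (measurable_of_countable _).aemeasurable (h.aemeasurable_totalCount t)

/-! ### The masses of ν as time integrals, and the recursion -/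

theorem IsNetwork.measurable_batchPMF (h : IsNetwork μ lam q T S X) (b : ℕ) (t : ℝ≥0)
    (i : Fin J → ℕ) : Measurable fun τ : ℝ≥0 => batchPMF μ S X b (t - τ) i := by
  have hs := h.measurable_batchOccupancy_sub b t (measurableSet_singleton i)
  have hm := (measurable_measure_prodMk_left (ν := μ) hs).ennreal_toReal
  convert! hm using 3 with τ
  unfold batchPMF
  rw [measureReal_def]
  congr 2
  ext ω
  simp [funext_iff]

/-- Tonelli, with the rate as density of the intensity. Since ν is finite, this also yields
integrability. -/
theorem IsNetwork.lintegral_batchPMF (h : IsNetwork μ lam q T S X) (b : ℕ) (t : ℝ≥0)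
    (i : Fin J → ℕ) :
    ∫⁻ τ in Set.Icc 0 t, ENNReal.ofReal ((lam τ : ℝ) * batchPMF μ S X b (t - τ) i) ∂lebesgue =
      batchIntensity μ lam S X b t {i} := by
  have hl := h.lintegral_batchIntensity b t (Set.indicator {i} 1)
  rw [lintegral_indicator_one (measurableSet_singleton i)] at hl
  have hpmf (τ : ℝ≥0) : ∫⁻ ω, Set.indicator {i} 1 (batchOccupancy S X b (t - τ) ω) ∂μ =
      ENNReal.ofReal (batchPMF μ S X b (t - τ) i) := by
    have hset : {ω | ∀ k, batchOccupancy S X b (t - τ) ω k = i k} =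
        (fun ω => batchOccupancy S X b (t - τ) ω) ⁻¹' {i} := by
      ext ω; simp [funext_iff]
    have hm := (h.measurable_batchOccupancy_sub b t).comp (measurable_prodMk_left (x := τ))
    have hms : MeasurableSet ((fun ω => batchOccupancy S X b (t - τ) ω) ⁻¹' {i}) :=
      hm (measurableSet_singleton i)
    rw [batchPMF, ofReal_measureReal, hset,
      ← lintegral_indicator_one hms]
    refine lintegral_congr fun ω => ?_
    simp [Set.indicator]
  simp_rw [hpmf] at hl
  rw [hl, intensity, restrict_withDensity measurableSet_Iic,
    lintegral_withDensity_eq_lintegral_mul _ h.poisson.measurable_rate.coe_nnreal_ennreal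
      (h.measurable_batchPMF b t i).ennreal_ofReal]
  have hIcc : Set.Icc 0 t = Set.Iic t := by ext; simp
  rw [hIcc]
  refine lintegral_congr fun τ => ?_
  rw [ENNReal.ofReal_mul (NNReal.coe_nonneg _), ENNReal.ofReal_coe_nnreal]
  rfl

theorem rate_mul_batchPMF_nonneg (μ : Measure Ω) (lam : ℝ≥0 → ℝ≥0) (S : ℕ → Ω → Fin J → ℕ)
    (X : ℕ → Fin J → ℕ → ℝ≥0 → Ω → Option (Fin J)) (b : ℕ) (t : ℝ≥0) (i : Fin J → ℕ) (τ : ℝ≥0) :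
    0 ≤ (lam τ : ℝ) * batchPMF μ S X b (t - τ) i :=
  mul_nonneg (NNReal.coe_nonneg _) measureReal_nonneg

theorem IsNetwork.integrableOn_batchPMF (h : IsNetwork μ lam q T S X) (b : ℕ) (t : ℝ≥0)
    (i : Fin J → ℕ) :
    IntegrableOn (fun τ : ℝ≥0 => (lam τ : ℝ) * batchPMF μ S X b (t - τ) i) (Set.Icc 0 t)
      lebesgue := by
  have := h.isFiniteMeasure_batchIntensity b t
  have hm : Measurable fun τ : ℝ≥0 => (lam τ : ℝ) * batchPMF μ S X b (t - τ) i :=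
    h.poisson.measurable_rate.coe_nnreal_real.mul (h.measurable_batchPMF b t i)
  refine (lintegral_ofReal_ne_top_iff_integrable hm.aestronglyMeasurable
    (Eventually.of_forall (rate_mul_batchPMF_nonneg μ lam S X b t i))).1 ?_
  rw [h.lintegral_batchPMF]
  exact measure_ne_top _ _

theorem IsNetwork.integral_batchPMF (h : IsNetwork μ lam q T S X) (b : ℕ) (t : ℝ≥0)
    (i : Fin J → ℕ) :
    ∫ τ in Set.Icc 0 t, (lam τ : ℝ) * batchPMF μ S X b (t - τ) i ∂lebesgue =
      (batchIntensity μ lam S X b t {i}).toReal := by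
  rw [← h.lintegral_batchPMF, integral_eq_lintegral_of_nonneg_ae
    (Eventually.of_forall (rate_mul_batchPMF_nonneg μ lam S X b t i))
    (h.integrableOn_batchPMF b t i).aestronglyMeasurable]

theorem IsNetwork.mul_occupancyPMF (h : IsNetwork μ lam q T S X) (b : ℕ) (t : ℝ≥0) (v : Fin J)
    (n : Fin J → ℕ) :
    (n v : ℝ) * occupancyPMF μ T S X t n =
      ∑ i ∈ Finset.Iic n, (i v : ℝ) * occupancyPMF μ T S X t (n - i) *
        ∫ τ in Set.Icc 0 t, (lam τ : ℝ) * batchPMF μ S X b (t - τ) i ∂lebesgue := by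
  have := h.isFiniteMeasure_batchIntensity b t
  have hP := congrArg ENNReal.toReal
    (compoundPoisson_singleton (batchIntensity μ lam S X b t) v n)
  rw [ENNReal.toReal_sum fun i _ => ENNReal.mul_ne_top
    (ENNReal.mul_ne_top (ENNReal.natCast_ne_top _) (measure_ne_top _ _)) (measure_ne_top _ _)] at hP
  simp only [ENNReal.toReal_mul, ENNReal.toReal_natCast] at hP
  simp_rw [h.occupancyPMF_eq, h.map_totalCount b, h.integral_batchPMF]
  exact hP

end BatchNetwork

/-- The queues are numbered from `0`, so that `1 ≤ v` says that `v` is not the first queue. The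
distribution of `C_b(s)` is the same for every batch `b`. -/
theorem theorem5p1 {Ω : Type*} [MeasurableSpace Ω] {μ : Measure Ω} [IsProbabilityMeasure μ] {J : ℕ}
    {lam : ℝ≥0 → ℝ≥0} {q : Fin J → Fin J → ℝ≥0 → ℝ} {T : ℕ → Ω → ℝ≥0∞}
    {S : ℕ → Ω → Fin J → ℕ} {X : ℕ → Fin J → ℕ → ℝ≥0 → Ω → Option (Fin J)}
    (hnet : BatchNetwork.IsNetwork μ lam q T S X)
    (b : ℕ) (t : ℝ≥0) (v : Fin J) (hv : 1 ≤ (v : ℕ))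
    (n : Fin J → ℕ) (hnv : 1 ≤ n v) (hn : ∀ k, v < k → n k = 0) :
    (∀ i : Fin J → ℕ, IntegrableOn
      (fun τ : ℝ≥0 => (lam τ : ℝ) * BatchNetwork.batchPMF μ S X b (t - τ) i)
      (Set.Icc 0 t) BatchNetwork.lebesgue) ∧
    BatchNetwork.occupancyPMF μ T S X t n =
      ∑ i ∈ Finset.Iic n with 1 ≤ i v,
        (i v : ℝ) / (n v : ℝ) * BatchNetwork.occupancyPMF μ T S X t (n - i) *
          ∫ τ in Set.Icc 0 t, (lam τ : ℝ) * BatchNetwork.batchPMF μ S X b (t - τ) i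
            ∂BatchNetwork.lebesgue := by
  refine ⟨hnet.integrableOn_batchPMF b t, ?_⟩
  have hnv' : (n v : ℝ) ≠ 0 := by exact_mod_cast Nat.one_le_iff_ne_zero.1 hnv
  -- After multiplication by n v this is Panjer's recursion; the terms it has in excess, those with
  -- i v = 0, vanish.
  rw [← mul_right_inj' hnv', hnet.mul_occupancyPMF b t v n, Finset.mul_sum, Finset.sum_filter]
  refine Finset.sum_congr rfl fun i _ => ?_
  split_ifs with hi
  · field_simp
  · rw [Nat.eq_zero_of_not_pos hi]
    simp
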